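/- Let $k$ be an algebraically closed field of characteristic $0$, let $X$ be a nonsingular variety over $k$ (for instance a projective one) with a Poisson structure $\Lambda_0$, i.e. a Poisson $k$-algebra bracket $\{-,-\}$ on $\mathcal{O}_X$, and let $(L,\nabla)$ be a Poisson invertible sheaf on $(X,\Lambda_0)$: an invertible $\mathcal{O}_X$-module $L$ with a flat Poisson connection, i.e. a $k$-bilinear bracket $\{-,-\}_L:\mathcal{O}_X\otimes_k L\to L$ with $\{fg,s\}_L=f\{g,s\}_L+g\{f,s\}_L$, $\{f,gs\}_L=\{f,g\}s+g\{f,s\}_L$ and $\{f,\{g,s\}_L\}_L=\{\{f,g\},s\}_L+\{g,\{f,s\}_L\}_L$. Write $L^\bullet$ for the complex $L\xrightarrow{v_0}T_X\otimes L\xrightarrow{v_1}\wedge^2T_X\otimes L\to\cdots$, where $T_X\otimes L$ and $\wedge^2T_X\otimes L$ are identified with the sheaves of derivations and of alternating biderivations from $\mathcal{O}_X$ to $L$, $v_0(s)(f)=\{f,s\}_L$ and $v_1(\delta)(f,g)=\{f,\delta(g)\}_L-\{g,\delta(f)\}_L-\delta(\{f,g\})$; write $\mathcal{O}_X^\bullet$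 for the complex obtained in this way from $L=\mathcal{O}_X$ with $\{-,-\}_L=\{-,-\}$ (the Lichnerowicz–Poisson complex), and $\mathbb{H}^i(X,\Lambda_0,L^\bullet,\nabla)$, $\mathbb{H}^i(X,\Lambda_0,\mathcal{O}_X^\bullet)$ for the hypercohomology groups. Elements of $\mathbb{H}^1$ are represented by Čech cocycles $(\{a_{ij}\},\{w_i\})$ of degree-$0$ terms on $U_{ij}$ and degree-$1$ terms on $U_i$ with $a_{ij}+a_{jk}=a_{ik}$, $v_0(a_{ij})=w_j-w_i$, $v_1(w_i)=0$, and the coboundaries are the $(\{t_j-t_i\},\{v_0(t_i)\})$. For $s\in\mathbb{H}^0(X,\Lambda_0,L^\bullet,\nabla)$, i.e. $s\in\Gamma(X,L)$ with $\nabla s=0$, the maps $a\mapsto a\otimes s$ form a morphism of complexes $\mathcal{O}_X^\bullet\to L^\bullet$ and induce $$m_1:\mathbb{H}^1(X,\Lambda_0,\mathcal{O}_X^\bullet)\to \mathrm{Hom}\big(\mathbb{H}^0(X,\Lambda_0,L^\bullet,\nabla),\mathbb{H}^1(X,\Lambda_0,L^\bullet,\nabla)\big).$$ Let $(\mathcal{L}_a,\nabla_a)$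 be a first-order deformation of $(L,\nabla)$: a Poisson invertible sheaf over $k[\epsilon]$ ($\epsilon^2=0$) on $X\times\mathrm{Spec}\,k[\epsilon]$ with the $k[\epsilon]$-bilinear extension of $\{-,-\}$, together with an identification of its restriction to $X$ with $(L,\nabla)$. Suppose that it corresponds to $a\in\mathbb{H}^1(X,\Lambda_0,\mathcal{O}_X^\bullet)$: on some open cover $\{U_i\}$ it has local generators $e_i$ with $e_j=(f_{ij}+\epsilon g_{ij})e_i$ and $\{h,e_i\}=(T_i(h)+\epsilon W_i(h))e_i$ for $h\in\mathcal{O}_X$, where $f_{ij}$ is invertible and $T_i,W_i$ are vector fields on $U_i$, and $a$ is the class of the cocycle $(\{g_{ij}/f_{ij}\},\{W_i\})$. Then a section $s\in\mathbb{H}^0(X,\Lambda_0,L^\bullet,\nabla)$ extends to $(\mathcal{L}_a,\nabla_a)$, that is, $s$ lies in the image of the restriction map $\mathbb{H}^0(X\times \mathrm{Spec}\,k[\epsilon],\Lambda_0,\mathcal{L}_a^\bullet,\nabla_a)\to\mathbb{H}^0(X,\Lambda_0,L^\bullet,\nabla)$, if and only if $m_1(a)(s)=0$ in $\mathbb{H}^1(X,\Lambda_0,L^\bullet,\nabla)$.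 -/

import Mathlib

open CategoryTheory TopologicalSpace Opposite AlgebraicGeometry

universe u

noncomputable section

namespace PoissonSheaf

/-! ### Spaces with a sheaf of commutative `K`-algebras and sheaves of modules on them -/

/-- A topological space with a sheaf of commutative `K`-algebras; the `K`-algebra structure
is given by the ring homomorphism from `K` to the global functions. -/
structure AlgSpace (K : Type u) [CommRing K] where
  space : TopCat.{u}
  sheaf : TopCat.Sheaf CommRingCat.{u} space
  scalar : K →+* sheaf.presheaf.obj (op ⊤)

namespace AlgSpace

variable {K : Type u} [CommRing K] (S : AlgSpace K)

/-- The ring of functions on an open set. -/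
def Fn (U : Opens S.space) : Type u := S.sheaf.presheaf.obj (op U)

instance (U : Opens S.space) : CommRing (S.Fn U) :=
  inferInstanceAs (CommRing (S.sheaf.presheaf.obj (op U)))

/-- Restriction of functions. -/
def res {U V : Opens S.space} (h : V ≤ U) : S.Fn U →+* S.Fn V :=
  (S.sheaf.presheaf.map (homOfLE h).op).hom

/-- Elements of `K` as functions on an open set. -/
def const (U : Opens S.space) : K →+* S.Fn U := (S.res le_top).comp S.scalar

/-- The structure sheaf as a sheaf of rings. -/
abbrev ringSheaf : Sheaf (Opens.grothendieckTopology S.space) RingCat.{u} :=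
  (sheafCompose _ (forget₂ CommRingCat RingCat.{u})).obj S.sheaf

/-- Sheaves of modules over the structure sheaf. -/
abbrev Modules := SheafOfModules.{u} S.ringSheaf

variable {S}

/-- The sections of a sheaf of modules on an open set. -/
def Sec (M : S.Modules) (U : Opens S.space) : Type u := M.val.presheaf.obj (op U)

instance (M : S.Modules) (U : Opens S.space) : AddCommGroup (Sec M U) :=
  inferInstanceAs (AddCommGroup (M.val.presheaf.obj (op U)))

instance (M : S.Modules) (U : Opens S.space) : Module (S.Fn U) (Sec M U) :=
  inferInstanceAs (Module (S.ringSheaf.obj.obj (op U)) (M.val.obj (op U)))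

/-- Restriction of sections. -/
def resM (M : S.Modules) {U V : Opens S.space} (h : V ≤ U) : Sec M U →+ Sec M V :=
  (M.val.presheaf.map (homOfLE h).op).hom

theorem res_res {U V W : Opens S.space} (h : V ≤ U) (h' : W ≤ V) (f : S.Fn U) :
    S.res h' (S.res h f) = S.res (h'.trans h) f := by
  change (S.sheaf.presheaf.map (homOfLE h).op ≫ S.sheaf.presheaf.map (homOfLE h').op).hom f = _
  rw [← Functor.map_comp]; rfl

theorem res_self {U : Opens S.space} (f : S.Fn U) : S.res le_rfl f = f := by
  change (S.sheaf.presheaf.map (𝟙 (op U))).hom f = _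
  rw [CategoryTheory.Functor.map_id]; rfl

theorem res_const {U V : Opens S.space} (h : V ≤ U) (c : K) :
    S.res h (S.const U c) = S.const V c := res_res _ _ _

theorem resM_resM (M : S.Modules) {U V W : Opens S.space} (h : V ≤ U) (h' : W ≤ V) (m : Sec M U) :
    resM M h' (resM M h m) = resM M (h'.trans h) m := by
  change (M.val.presheaf.map (homOfLE h).op ≫ M.val.presheaf.map (homOfLE h').op).hom m = _
  rw [← Functor.map_comp]; rfl

theorem resM_self (M : S.Modules) {U : Opens S.space} (m : Sec M U) : resM M le_rfl m = m := by
  change (M.val.presheaf.map (𝟙 (op U))).hom m = _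
  rw [CategoryTheory.Functor.map_id]; rfl

theorem resM_smul (M : S.Modules) {U V : Opens S.space} (h : V ≤ U) (f : S.Fn U) (m : Sec M U) :
    resM M h (f • m) = S.res h f • resM M h m :=
  M.val.map_smul (homOfLE h).op f m

/-- The structure sheaf as a sheaf of modules over itself. -/
abbrev unit (S : AlgSpace K) : S.Modules := SheafOfModules.unit S.ringSheaf

/-- A section `e` over `U` freely generates the module on `U`, that is,
`r ↦ r e` is an isomorphism from the structure sheaf of `U` to the restriction of `M` to `U`. -/
def IsFrame (M : S.Modules) {U : Opens S.space} (e : Sec M U) : Prop :=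
  ∀ (V : Opens S.space) (h : V ≤ U),
    Function.Bijective fun r : S.Fn V => (r • resM M h e : Sec M V)

/-- An invertible sheaf: a sheaf of modules which is locally free of rank one. -/
def IsInvertible (M : S.Modules) : Prop :=
  ∀ x : S.space, ∃ (U : Opens S.space) (e : Sec M U), x ∈ U ∧ IsFrame M e

end AlgSpace

open AlgSpace

/-- A scheme over `Spec k`, viewed as a space with a sheaf of `k`-algebras. -/
def ofScheme {k : Type u} [CommRing k] (X : Scheme.{u}) (π : X ⟶ Spec (.of k)) : AlgSpace k where
  space := X.toTopCat
  sheaf := X.sheaf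
  scalar := ((Scheme.ΓSpecIso (.of k)).inv ≫ π.appTop).hom


/-! ### Poisson structures and Poisson modules -/

section Poisson

variable {K : Type u} [CommRing K]

/-- A sheaf of Poisson `K`-algebra structures on the structure sheaf of `S`. -/
structure PoissonStr (S : AlgSpace K) where
  bracket : ∀ U : Opens S.space, S.Fn U → S.Fn U → S.Fn U
  add_left : ∀ U (f g h : S.Fn U), bracket U (f + g) h = bracket U f h + bracket U g h
  scalar_left : ∀ U (c : K) (f g : S.Fn U),
    bracket U (S.const U c * f) g = S.const U c * bracket U f g
  add_right : ∀ U (f g h : S.Fn U), bracket U f (g + h) = bracket U f g + bracket U f h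
  alternating : ∀ U (f : S.Fn U), bracket U f f = 0
  leibniz : ∀ U (f g h : S.Fn U), bracket U (f * g) h = f * bracket U g h + g * bracket U f h
  jacobi : ∀ U (f g h : S.Fn U),
    bracket U f (bracket U g h) + bracket U g (bracket U h f) + bracket U h (bracket U f g) = 0
  res_bracket : ∀ {U V : Opens S.space} (h : V ≤ U) (f g : S.Fn U),
    S.res h (bracket U f g) = bracket V (S.res h f) (S.res h g)

namespace PoissonStr

variable {S : AlgSpace K} (P : PoissonStr S)

theorem skew (U) (f g : S.Fn U) : P.bracket U f g = -P.bracket U g f := by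
  have h := P.alternating U (f + g)
  rw [P.add_left, P.add_right, P.add_right, P.alternating, P.alternating] at h
  linear_combination h

theorem leibniz_right (U) (f g h : S.Fn U) :
    P.bracket U f (g * h) = P.bracket U f g * h + g * P.bracket U f h := by
  rw [P.skew, P.leibniz, P.skew U g, P.skew U h]; ring

theorem scalar_right (U) (c : K) (f g : S.Fn U) :
    P.bracket U f (S.const U c * g) = S.const U c * P.bracket U f g := by
  rw [P.skew, P.scalar_left, P.skew U g]; ring

end PoissonStr

/-- A flat Poisson connection on a sheaf of modules `M`: a `K`-bilinear bracket of functions with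
sections of `M`, a derivation in the first argument, satisfying the Leibniz identity in the second,
and giving a Lie action of the Poisson Lie algebra of functions. -/
structure FlatConn {S : AlgSpace K} (P : PoissonStr S) (M : S.Modules) where
  bracket : ∀ U : Opens S.space, S.Fn U → Sec M U → Sec M U
  add_left : ∀ U (f g : S.Fn U) (s : Sec M U),
    bracket U (f + g) s = bracket U f s + bracket U g s
  add_right : ∀ U (f : S.Fn U) (s t : Sec M U),
    bracket U f (s + t) = bracket U f s + bracket U f t
  scalar_left : ∀ U (c : K) (f : S.Fn U) (s : Sec M U),
    bracket U (S.const U c * f) s = S.const U c • bracket U f s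
  scalar_right : ∀ U (c : K) (f : S.Fn U) (s : Sec M U),
    bracket U f (S.const U c • s) = S.const U c • bracket U f s
  leibniz_left : ∀ U (f g : S.Fn U) (s : Sec M U),
    bracket U (f * g) s = f • bracket U g s + g • bracket U f s
  leibniz_right : ∀ U (f g : S.Fn U) (s : Sec M U),
    bracket U f (g • s) = P.bracket U f g • s + g • bracket U f s
  flat : ∀ U (f g : S.Fn U) (s : Sec M U),
    bracket U f (bracket U g s) = bracket U (P.bracket U f g) s + bracket U g (bracket U f s)
  res_bracket : ∀ {U V : Opens S.space} (h : V ≤ U) (f : S.Fn U) (s : Sec M U),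
    resM M h (bracket U f s) = bracket V (S.res h f) (resM M h s)

/-- The Poisson bracket as a flat Poisson connection on the structure sheaf. -/
def PoissonStr.toFlatConn {S : AlgSpace K} (P : PoissonStr S) : FlatConn P S.unit where
  bracket := P.bracket
  add_left := P.add_left
  add_right := P.add_right
  scalar_left := P.scalar_left
  scalar_right := P.scalar_right
  leibniz_left := P.leibniz
  leibniz_right := P.leibniz_right
  flat U f g h := by
    change P.bracket U f (P.bracket U g h) = P.bracket U (P.bracket U f g) h +
      P.bracket U g (P.bracket U f h)
    have h1 := P.jacobi U f g h
    have h2 : P.bracket U g (P.bracket U h f) = -P.bracket U g (P.bracket U f h) := by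
      have h3 := P.add_right U g (P.bracket U h f) (P.bracket U f h)
      rw [P.skew U h f, neg_add_cancel] at h3
      have h4 := P.add_right U g 0 0
      rw [add_zero] at h4
      rw [P.skew U h f]
      linear_combination -h3 - h4
    rw [h2, P.skew U h] at h1
    linear_combination h1
  res_bracket := P.res_bracket

/-! ### The complex of a Poisson module -/

variable {S : AlgSpace K}

/-- The open subsets of `U`. -/
abbrev OpensIn {T : TopCat.{u}} (U : Opens T) : Type u := {V : Opens T // V ≤ U}

/-- `K`-derivations of the structure sheaf over `U` with values in `M`, that is, sections over `U`
of `ℋom(Ω¹, M)`: compatible families of derivations on the open subsets of `U`. -/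
def derOn (M : S.Modules) (U : Opens S.space) :
    AddSubgroup (∀ V : OpensIn U, S.Fn V.1 → Sec M V.1) where
  carrier := {D |
    (∀ V (f g : S.Fn V.1), D V (f + g) = D V f + D V g) ∧
    (∀ V (c : K) (f : S.Fn V.1), D V (S.const V.1 c * f) = S.const V.1 c • D V f) ∧
    (∀ V (f g : S.Fn V.1), D V (f * g) = f • D V g + g • D V f) ∧
    (∀ (V W : OpensIn U) (i : W.1 ≤ V.1) (f : S.Fn V.1),
      resM M i (D V f) = D W (S.res i f))}
  zero_mem' := by
    refine ⟨?_, ?_, ?_, ?_⟩ <;> intros <;> simp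
  add_mem' := by
    rintro D E ⟨a1, a2, a3, a4⟩ ⟨b1, b2, b3, b4⟩
    refine ⟨?_, ?_, ?_, ?_⟩ <;> intros <;> simp only [Pi.add_apply, map_add, smul_add]
    · rw [a1, b1]; abel
    · rw [a2, b2]
    · rw [a3, b3]; abel
    · rw [a4, b4]
  neg_mem' := by
    rintro D ⟨a1, a2, a3, a4⟩
    refine ⟨?_, ?_, ?_, ?_⟩ <;> intros <;> simp only [Pi.neg_apply, map_neg, smul_neg]
    · rw [a1]; abel
    · rw [a2]
    · rw [a3]; abel
    · rw [a4]

/-- Alternating biderivations over `K` of the structure sheaf over `U` with values in `M`, that is,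
sections over `U` of `ℋom(⋀²Ω¹, M)`. -/
def biderOn (M : S.Modules) (U : Opens S.space) :
    AddSubgroup (∀ V : OpensIn U, S.Fn V.1 → S.Fn V.1 → Sec M V.1) where
  carrier := {B |
    (∀ V (f g k : S.Fn V.1), B V (f + g) k = B V f k + B V g k) ∧
    (∀ V (c : K) (f g : S.Fn V.1), B V (S.const V.1 c * f) g = S.const V.1 c • B V f g) ∧
    (∀ V (f g k : S.Fn V.1), B V (f * g) k = f • B V g k + g • B V f k) ∧
    (∀ V (f : S.Fn V.1), B V f f = 0) ∧
    (∀ (V W : OpensIn U) (i : W.1 ≤ V.1) (f g : S.Fn V.1),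
      resM M i (B V f g) = B W (S.res i f) (S.res i g))}
  zero_mem' := by
    refine ⟨?_, ?_, ?_, ?_, ?_⟩ <;> intros <;> simp
  add_mem' := by
    rintro D E ⟨a1, a2, a3, a5, a4⟩ ⟨b1, b2, b3, b5, b4⟩
    refine ⟨?_, ?_, ?_, ?_, ?_⟩ <;> intros <;> simp only [Pi.add_apply, map_add, smul_add]
    · rw [a1, b1]; abel
    · rw [a2, b2]
    · rw [a3, b3]; abel
    · rw [a5, b5]; abel
    · rw [a4, b4]
  neg_mem' := by
    rintro D ⟨a1, a2, a3, a5, a4⟩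
    refine ⟨?_, ?_, ?_, ?_, ?_⟩ <;> intros <;> simp only [Pi.neg_apply, map_neg, smul_neg]
    · rw [a1]; abel
    · rw [a2]
    · rw [a3]; abel
    · rw [a5, neg_zero]
    · rw [a4]

/-- The presheaf (in fact sheaf) `ℋom(Ω¹, M)`. -/
def derPresheaf (M : S.Modules) : TopCat.Presheaf AddCommGrpCat.{u} S.space where
  obj U := .of (derOn M U.unop)
  map {U V} i := AddCommGrpCat.ofHom
    { toFun := fun D => ⟨fun W => D.1 ⟨W.1, W.2.trans i.unop.le⟩,
        fun _ => D.2.1 ⟨_, _⟩, fun _ => D.2.2.1 ⟨_, _⟩, fun _ => D.2.2.2.1 ⟨_, _⟩,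
        fun _ _ h => D.2.2.2.2 ⟨_, _⟩ ⟨_, _⟩ h⟩
      map_zero' := rfl
      map_add' := fun _ _ => rfl }

/-- The presheaf (in fact sheaf) `ℋom(⋀²Ω¹, M)`. -/
def biderPresheaf (M : S.Modules) : TopCat.Presheaf AddCommGrpCat.{u} S.space where
  obj U := .of (biderOn M U.unop)
  map {U V} i := AddCommGrpCat.ofHom
    { toFun := fun B => ⟨fun W => B.1 ⟨W.1, W.2.trans i.unop.le⟩,
        fun _ => B.2.1 ⟨_, _⟩, fun _ => B.2.2.1 ⟨_, _⟩, fun _ => B.2.2.2.1 ⟨_, _⟩,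
        fun _ => B.2.2.2.2.1 ⟨_, _⟩,
        fun _ _ h => B.2.2.2.2.2 ⟨_, _⟩ ⟨_, _⟩ h⟩
      map_zero' := rfl
      map_add' := fun _ _ => rfl }

namespace FlatConn

variable {P : PoissonStr S} {M : S.Modules} (C : FlatConn P M)

theorem bracket_zero (U) (f : S.Fn U) : C.bracket U f 0 = 0 := by
  have h := C.add_right U f 0 0
  rw [add_zero] at h
  exact left_eq_add.mp h

/-- `v₀(s)(f) = {f, s}` -/
def v0 (U : Opens S.space) : Sec M U →+ derOn M U where
  toFun s := ⟨fun V f => C.bracket V.1 f (resM M V.2 s),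
    fun V f g => C.add_left V.1 f g _,
    fun V c f => C.scalar_left V.1 c f _,
    fun V f g => C.leibniz_left V.1 f g _,
    fun V W i f => by
      change resM M i (C.bracket V.1 f (resM M V.2 s)) = C.bracket W.1 (S.res i f) (resM M W.2 s)
      rw [C.res_bracket, resM_resM]⟩
  map_zero' := by
    refine Subtype.ext ?_
    funext V f
    change C.bracket V.1 f (resM M V.2 0) = 0
    rw [map_zero, C.bracket_zero]
  map_add' s t := by
    refine Subtype.ext ?_
    funext V f
    change C.bracket V.1 f (resM M V.2 (s + t)) = _
    rw [map_add, C.add_right]; rfl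

/-- `v₁(δ)(f, g) = {f, δ(g)} - {g, δ(f)} - δ({f, g})` -/
def v1 (U : Opens S.space) : derOn M U →+ biderOn M U where
  toFun D := ⟨fun V f g => C.bracket V.1 f (D.1 V g) - C.bracket V.1 g (D.1 V f)
      - D.1 V (P.bracket V.1 f g), by
    obtain ⟨D, a1, a2, a3, a4⟩ := D
    have hz : ∀ V, D V 0 = 0 := fun V => by
      have h := a1 V 0 0
      rw [add_zero] at h
      exact left_eq_add.mp h
    refine ⟨?_, ?_, ?_, ?_, ?_⟩
    · intro V f g k
      simp only [C.add_left, a1, C.add_right, P.add_left]; abel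
    · intro V c f g
      simp only [C.scalar_left, a2, C.scalar_right, P.scalar_left, smul_sub]
    · intro V f g k
      simp only [C.leibniz_left, a3, C.add_right, C.leibniz_right, P.leibniz, a1, smul_sub]
      rw [P.skew V.1 k f, P.skew V.1 k g]
      simp only [neg_smul]; abel
    · intro V f
      simp only [P.alternating, hz]; abel
    · intro V W i f g
      simp only [map_sub, C.res_bracket, a4 V W i, P.res_bracket]⟩
  map_zero' := by
    refine Subtype.ext ?_
    funext V f g
    change C.bracket V.1 f 0 - C.bracket V.1 g 0 - 0 = 0
    rw [C.bracket_zero, C.bracket_zero]; abel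
  map_add' D E := by
    refine Subtype.ext ?_
    funext V f g
    change C.bracket V.1 f (D.1 V g + E.1 V g) - C.bracket V.1 g (D.1 V f + E.1 V f) -
      (D.1 V _ + E.1 V _) = (_ - _ - _) + (_ - _ - _)
    rw [C.add_right, C.add_right]; abel

/-- The complex `M → T ⊗ M → ⋀²T ⊗ M` of a flat Poisson connection, in degrees `0, 1, 2`. -/
def complex : ShortComplex (TopCat.Presheaf AddCommGrpCat.{u} S.space) where
  X₁ := M.val.presheaf
  X₂ := derPresheaf M
  X₃ := biderPresheaf M
  f :=
    { app := fun U => AddCommGrpCat.ofHom (C.v0 U.unop)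
      naturality := by
        intro U V i
        ext s
        refine Subtype.ext ?_
        funext W f
        exact congrArg (C.bracket W.1 f) (resM_resM M i.unop.le W.2 s) }
  g :=
    { app := fun U => AddCommGrpCat.ofHom (C.v1 U.unop)
      naturality := fun _ _ _ => rfl }
  zero := by
    ext U s
    refine Subtype.ext ?_
    funext V f g
    change C.bracket V.1 f (C.bracket V.1 g _) - C.bracket V.1 g (C.bracket V.1 f _)
      - C.bracket V.1 (P.bracket V.1 f g) _ = 0
    rw [C.flat]; abel

end FlatConn

end Poisson

/-! ### Čech hypercohomology in degrees `0` and `1` -/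

section Cech

variable {T : TopCat.{u}}

/-- Restriction in a presheaf of abelian groups. -/
def rs (F : TopCat.Presheaf AddCommGrpCat.{u} T) {U V : Opens T} (h : V ≤ U) :
    F.obj (op U) →+ F.obj (op V) :=
  (F.map (homOfLE h).op).hom

theorem rs_rs (F : TopCat.Presheaf AddCommGrpCat.{u} T) {U V W : Opens T} (h : V ≤ U) (h' : W ≤ V)
    (s : F.obj (op U)) : rs F h' (rs F h s) = rs F (h'.trans h) s := by
  change (F.map (homOfLE h).op ≫ F.map (homOfLE h').op).hom s = _
  rw [← Functor.map_comp]; rfl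

theorem rs_self (F : TopCat.Presheaf AddCommGrpCat.{u} T) {U : Opens T} (s : F.obj (op U)) :
    rs F le_rfl s = s := by
  change (F.map (𝟙 (op U))).hom s = _
  rw [CategoryTheory.Functor.map_id]; rfl

/-- A morphism of presheaves on sections. -/
def ap {F G : TopCat.Presheaf AddCommGrpCat.{u} T} (φ : F ⟶ G) (U : Opens T) :
    F.obj (op U) →+ G.obj (op U) :=
  (φ.app (op U)).hom

theorem ap_rs {F G : TopCat.Presheaf AddCommGrpCat.{u} T} (φ : F ⟶ G) {U V : Opens T} (h : V ≤ U)
    (s : F.obj (op U)) : ap φ V (rs F h s) = rs G h (ap φ U s) :=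
  ConcreteCategory.congr_hom (φ.naturality (homOfLE h).op) s

theorem ap_comp {F G H : TopCat.Presheaf AddCommGrpCat.{u} T} (φ : F ⟶ G) (ψ : G ⟶ H)
    (U : Opens T) (s : F.obj (op U)) : ap (φ ≫ ψ) U s = ap ψ U (ap φ U s) := rfl

/-- An open cover indexed by the points: `nbhd x` is an open neighbourhood of `x`. -/
structure PtCover (T : TopCat.{u}) where
  nbhd : T → Opens T
  mem : ∀ x, x ∈ nbhd x

/-- `𝒰 ≤ 𝒱` when `𝒱` refines `𝒰`. Every open cover is refined by one indexed by the points. -/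
instance : Preorder (PtCover T) where
  le 𝒰 𝒱 := ∀ x, 𝒱.nbhd x ≤ 𝒰.nbhd x
  le_refl _ _ := le_rfl
  le_trans _ _ _ h h' x := (h' x).trans (h x)

instance : Nonempty (PtCover T) := ⟨⟨fun _ => ⊤, fun _ => trivial⟩⟩

instance : IsDirectedOrder (PtCover T) where
  directed 𝒰 𝒱 := ⟨⟨fun x => 𝒰.nbhd x ⊓ 𝒱.nbhd x, fun x => ⟨𝒰.mem x, 𝒱.mem x⟩⟩,
    fun _ => inf_le_left, fun _ => inf_le_right⟩

variable (C : ShortComplex (TopCat.Presheaf AddCommGrpCat.{u} T))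

/-- The hypercohomology of `C` in degree `0`, where `C` is regarded as the beginning, in degrees
`0, 1, 2`, of a complex of sheaves in degrees `≥ 0`: the global sections with differential zero. -/
def H0 : AddSubgroup (C.X₁.obj (op ⊤)) := (ap C.f ⊤).ker

variable (𝒰 : PtCover T)

/-- Total Čech cochains of degree `0`. -/
abbrev C0 : Type u := ∀ x, C.X₁.obj (op (𝒰.nbhd x))

/-- Total Čech cochains of degree `1`. -/
abbrev C1 : Type u :=
  (∀ x y, C.X₁.obj (op (𝒰.nbhd x ⊓ 𝒰.nbhd y))) × (∀ x, C.X₂.obj (op (𝒰.nbhd x)))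

/-- Total Čech cochains of degree `2`. -/
abbrev C2 : Type u :=
  (∀ x y z, C.X₁.obj (op (𝒰.nbhd x ⊓ 𝒰.nbhd y ⊓ 𝒰.nbhd z))) ×
    (∀ x y, C.X₂.obj (op (𝒰.nbhd x ⊓ 𝒰.nbhd y))) × (∀ x, C.X₃.obj (op (𝒰.nbhd x)))

/-- The total differential in degree `0`: `t ↦ (δt, dt)`. -/
def d0 : C0 C 𝒰 →+ C1 C 𝒰 where
  toFun t := (fun x y => rs C.X₁ inf_le_right (t y) - rs C.X₁ inf_le_left (t x),
    fun x => ap C.f _ (t x))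
  map_zero' := by
    ext <;> simp
  map_add' s t := by
    ext <;> simp; abel

/-- The total differential in degree `1`: `(a, w) ↦ (δa, da - δw, dw)`. -/
def d1 : C1 C 𝒰 →+ C2 C 𝒰 where
  toFun c :=
    (fun x y z => rs C.X₁ (inf_le_inf_right _ inf_le_right) (c.1 y z)
        - rs C.X₁ (inf_le_inf_right _ inf_le_left) (c.1 x z)
        + rs C.X₁ inf_le_left (c.1 x y),
      fun x y => ap C.f _ (c.1 x y) - (rs C.X₂ inf_le_right (c.2 y) - rs C.X₂ inf_le_left (c.2 x)),
      fun x => ap C.g _ (c.2 x))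
  map_zero' := by
    ext <;> simp
  map_add' s t := by
    ext <;> simp <;> abel

/-- Total Čech cocycles of degree `1`. -/
abbrev Z1 : AddSubgroup (C1 C 𝒰) := (d1 C 𝒰).ker

/-- Total Čech coboundaries of degree `1`, as a subgroup of the cocycles. -/
abbrev B1 : AddSubgroup (Z1 C 𝒰) := (d0 C 𝒰).range.addSubgroupOf (Z1 C 𝒰)

/-- The Čech hypercohomology of the cover `𝒰` in degree `1`. -/
abbrev CechH1 : Type u := Z1 C 𝒰 ⧸ B1 C 𝒰

variable {𝒰} {𝒱 : PtCover T}

/-- Restriction of cocycles to a refinement. -/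
def refineZ (h : 𝒰 ≤ 𝒱) : Z1 C 𝒰 →+ Z1 C 𝒱 where
  toFun c := ⟨(fun x y => rs C.X₁ (inf_le_inf (h x) (h y)) (c.1.1 x y),
    fun x => rs C.X₂ (h x) (c.1.2 x)), by
      have hc := c.2
      rw [AddMonoidHom.mem_ker] at hc ⊢
      refine Prod.ext ?_ (Prod.ext ?_ ?_)
      · funext x y z
        have := congrArg (rs C.X₁ (inf_le_inf (inf_le_inf (h x) (h y)) (h z)))
          (congrFun (congrFun (congrFun (congrArg Prod.fst hc) x) y) z)
        simpa [d1, rs_rs] using this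
      · funext x y
        have := congrArg (rs C.X₂ (inf_le_inf (h x) (h y)))
          (congrFun (congrFun (congrArg (fun c => c.2.1) hc) x) y)
        simpa [d1, rs_rs, ap_rs] using this
      · funext x
        have := congrArg (rs C.X₃ (h x)) (congrFun (congrArg (fun c => c.2.2) hc) x)
        simpa [d1, rs_rs, ap_rs] using this⟩
  map_zero' := by
    refine Subtype.ext (Prod.ext ?_ ?_) <;> ext <;> simp
  map_add' c d := by
    refine Subtype.ext (Prod.ext ?_ ?_) <;> ext <;> simp

/-- Restriction of Čech classes to a refinement. -/
def refine (h : 𝒰 ≤ 𝒱) : CechH1 C 𝒰 →+ CechH1 C 𝒱 :=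
  QuotientAddGroup.map _ _ (refineZ C h) (by
    rintro ⟨c, hc⟩ ⟨t, rfl⟩
    refine ⟨fun x => rs C.X₁ (h x) (t x), ?_⟩
    refine Prod.ext ?_ ?_
    · funext x y
      simp [d0, refineZ, rs_rs]
    · funext x
      simp [d0, refineZ, ap_rs])

open Classical in
/-- The hypercohomology of `C` in degree `1`, where `C` is regarded as the beginning, in degrees
`0, 1, 2`, of a complex of sheaves in degrees `≥ 0`: the direct limit over all open covers of the
first cohomology of the total Čech complex. -/
def H1 : Type u :=
  AddCommGroup.DirectLimit (CechH1 C) (fun _ _ h => refine C h)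

open Classical in
instance : AddCommGroup (H1 C) :=
  inferInstanceAs (AddCommGroup (AddCommGroup.DirectLimit (CechH1 C) (fun _ _ h => refine C h)))

open Classical in
/-- The class of a Čech cocycle. -/
def cls (𝒰 : PtCover T) : Z1 C 𝒰 →+ H1 C :=
  (AddCommGroup.DirectLimit.of (CechH1 C) (fun _ _ h => refine C h) 𝒰).comp
    (QuotientAddGroup.mk' _)

variable {C} {D : ShortComplex (TopCat.Presheaf AddCommGrpCat.{u} T)} (φ : C ⟶ D)

/-- The map on cocycles induced by a morphism of complexes. -/
def mapZ (𝒰 : PtCover T) : Z1 C 𝒰 →+ Z1 D 𝒰 where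
  toFun c := ⟨(fun x y => ap φ.τ₁ _ (c.1.1 x y), fun x => ap φ.τ₂ _ (c.1.2 x)), by
      have hc := c.2
      have e1 : ∀ U s, ap D.f U (ap φ.τ₁ U s) = ap φ.τ₂ U (ap C.f U s) := fun U s => by
        rw [← ap_comp, ← ap_comp, φ.comm₁₂]
      have e2 : ∀ U s, ap D.g U (ap φ.τ₂ U s) = ap φ.τ₃ U (ap C.g U s) := fun U s => by
        rw [← ap_comp, ← ap_comp, φ.comm₂₃]
      rw [AddMonoidHom.mem_ker] at hc ⊢
      refine Prod.ext ?_ (Prod.ext ?_ ?_)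
      · funext x y z
        have := congrArg (ap φ.τ₁ _) (congrFun (congrFun (congrFun (congrArg Prod.fst hc) x) y) z)
        simpa [d1, ap_rs] using this
      · funext x y
        have := congrArg (ap φ.τ₂ _) (congrFun (congrFun (congrArg (fun c => c.2.1) hc) x) y)
        simpa [d1, ap_rs, e1] using this
      · funext x
        have := congrArg (ap φ.τ₃ _) (congrFun (congrArg (fun c => c.2.2) hc) x)
        simpa [d1, e2] using this⟩
  map_zero' := by
    refine Subtype.ext (Prod.ext ?_ ?_) <;> ext <;> simp
  map_add' c d := by
    refine Subtype.ext (Prod.ext ?_ ?_) <;> ext <;> simp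

/-- The map on the Čech hypercohomology of a cover induced by a morphism of complexes. -/
def mapCechH1 (𝒰 : PtCover T) : CechH1 C 𝒰 →+ CechH1 D 𝒰 :=
  QuotientAddGroup.map _ _ (mapZ φ 𝒰) (by
    rintro ⟨c, hc⟩ ⟨t, rfl⟩
    refine ⟨fun x => ap φ.τ₁ _ (t x), ?_⟩
    refine Prod.ext ?_ ?_
    · funext x y
      simp [d0, mapZ, ap_rs]
    · funext x
      simp only [d0, mapZ, AddMonoidHom.coe_mk, ZeroHom.coe_mk]
      change ap D.f _ (ap φ.τ₁ _ _) = ap φ.τ₂ _ (ap C.f _ _)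
      rw [← ap_comp, ← ap_comp, φ.comm₁₂])

open Classical in
/-- The map on hypercohomology in degree `1` induced by a morphism of complexes. -/
def mapH1 : H1 C →+ H1 D :=
  AddCommGroup.DirectLimit.map (mapCechH1 φ) (by
    intro 𝒰 𝒱 h
    ext c
    refine congrArg (QuotientAddGroup.mk (s := B1 D 𝒱)) (Subtype.ext (Prod.ext ?_ ?_))
    · funext x y
      exact ap_rs φ.τ₁ _ _
    · funext x
      exact ap_rs φ.τ₂ _ _)

theorem mapH1_cls (𝒰 : PtCover T) (c : Z1 C 𝒰) :
    mapH1 φ (cls C 𝒰 c) = cls D 𝒰 (mapZ φ 𝒰 c) := by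
  classical
  exact AddCommGroup.DirectLimit.map_apply_of _ _ _

theorem H1_induction {p : H1 C → Prop} (a : H1 C) (h : ∀ 𝒰 c, p (cls C 𝒰 c)) : p a := by
  classical
  refine AddCommGroup.DirectLimit.induction_on a fun 𝒰 x => ?_
  obtain ⟨c, rfl⟩ := QuotientAddGroup.mk_surjective x
  exact h 𝒰 c

end Cech

/-! ### Multiplication by a Poisson section -/

section Mult

variable {K : Type u} [CommRing K] {S : AlgSpace K} {P : PoissonStr S} {M : S.Modules}

/-- A section of the structure sheaf as a function. -/
def asFn {U : Opens S.space} : Sec S.unit U →+ S.Fn U := AddMonoidHom.id (S.Fn U)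

theorem asFn_smul {U : Opens S.space} (f : S.Fn U) (r : Sec S.unit U) :
    asFn (f • r) = f * asFn r := rfl

theorem asFn_resM {U V : Opens S.space} (h : V ≤ U) (r : Sec S.unit U) :
    asFn (resM S.unit h r) = S.res h (asFn r) := rfl

/-- A section of the zeroth term of the complex of `M` as a section of `M`. -/
def FlatConn.sec (C : FlatConn P M) (s : H0 C.complex) : Sec M ⊤ := s.1

theorem FlatConn.bracket_sec (C : FlatConn P M) (s : H0 C.complex) (V : Opens S.space)
    (f : S.Fn V) : C.bracket V f (resM M le_top (C.sec s)) = 0 :=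
  congrFun (congrFun (congrArg Subtype.val s.2) ⟨V, le_top⟩) f

theorem FlatConn.sec_add (C : FlatConn P M) (s t : H0 C.complex) :
    C.sec (s + t) = C.sec s + C.sec t := rfl

/-- Multiplication of functions with a global section: `f ↦ f ⊗ s`. -/
def mul0 (s : Sec M ⊤) (U : Opens S.space) : Sec S.unit U →+ Sec M U where
  toFun f := asFn f • resM M le_top s
  map_zero' := by rw [map_zero, zero_smul]
  map_add' f g := by rw [map_add, add_smul]

/-- Multiplication of vector fields with a global section: `D ↦ D ⊗ s`. -/
def mul1 (s : Sec M ⊤) (U : Opens S.space) : derOn S.unit U →+ derOn M U where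
  toFun D := ⟨fun V f => asFn (D.1 V f) • resM M le_top s, by
    obtain ⟨D, a1, a2, a3, a4⟩ := D
    refine ⟨?_, ?_, ?_, ?_⟩
    · intro V f g
      simp only [a1, map_add, add_smul]
    · intro V c f
      simp only [a2, asFn_smul, mul_smul]
    · intro V f g
      simp only [a3, map_add, asFn_smul, add_smul, mul_smul]
    · intro V W i f
      simp only [resM_smul, ← asFn_resM, a4 V W i, resM_resM]⟩
  map_zero' := by
    refine Subtype.ext ?_
    funext V f
    exact zero_smul _ _
  map_add' D E := by
    refine Subtype.ext ?_
    funext V f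
    exact add_smul _ _ _

/-- Multiplication of bivector fields with a global section: `B ↦ B ⊗ s`. -/
def mul2 (s : Sec M ⊤) (U : Opens S.space) : biderOn S.unit U →+ biderOn M U where
  toFun B := ⟨fun V f g => asFn (B.1 V f g) • resM M le_top s, by
    obtain ⟨B, a1, a2, a3, a4, a5⟩ := B
    refine ⟨?_, ?_, ?_, ?_, ?_⟩
    · intro V f g k
      simp only [a1, map_add, add_smul]
    · intro V c f g
      simp only [a2, asFn_smul, mul_smul]
    · intro V f g k
      simp only [a3, map_add, asFn_smul, add_smul, mul_smul]
    · intro V f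
      simp only [a4, map_zero, zero_smul]
    · intro V W i f g
      simp only [resM_smul, ← asFn_resM, a5 V W i, resM_resM]⟩
  map_zero' := by
    refine Subtype.ext ?_
    funext V f g
    exact zero_smul _ _
  map_add' D E := by
    refine Subtype.ext ?_
    funext V f g
    exact add_smul _ _ _

theorem v1_mul1 (C : FlatConn P M) (s : H0 C.complex) (U : Opens S.space) (D : derOn S.unit U) :
    C.v1 U (mul1 (C.sec s) U D) = mul2 (C.sec s) U (P.toFlatConn.v1 U D) := by
  refine Subtype.ext ?_
  funext V f g
  change C.bracket V.1 f (asFn (D.1 V g) • resM M le_top (C.sec s)) -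
      C.bracket V.1 g (asFn (D.1 V f) • resM M le_top (C.sec s)) -
      asFn (D.1 V (P.bracket V.1 f g)) • resM M le_top (C.sec s) =
    (P.bracket V.1 f (asFn (D.1 V g)) - P.bracket V.1 g (asFn (D.1 V f)) -
      asFn (D.1 V (P.bracket V.1 f g))) • resM M le_top (C.sec s)
  rw [C.leibniz_right, C.leibniz_right, C.bracket_sec, C.bracket_sec, smul_zero, smul_zero,
    add_zero, add_zero, sub_smul, sub_smul]

theorem mul0_zero (U : Opens S.space) (f : Sec S.unit U) : mul0 (0 : Sec M ⊤) U f = 0 := by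
  change asFn f • resM M (le_top : U ≤ ⊤) 0 = 0
  rw [map_zero, smul_zero]

theorem mul0_add (s t : Sec M ⊤) (U : Opens S.space) (f : Sec S.unit U) :
    mul0 (s + t) U f = mul0 s U f + mul0 t U f := by
  change asFn f • resM M (le_top : U ≤ ⊤) (s + t) =
    asFn f • resM M (le_top : U ≤ ⊤) s + asFn f • resM M (le_top : U ≤ ⊤) t
  rw [map_add, smul_add]

theorem mul1_zero (U : Opens S.space) (D : derOn S.unit U) : mul1 (0 : Sec M ⊤) U D = 0 :=
  Subtype.ext (funext fun V => funext fun f => mul0_zero V.1 (D.1 V f))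

theorem mul1_add (s t : Sec M ⊤) (U : Opens S.space) (D : derOn S.unit U) :
    mul1 (s + t) U D = mul1 s U D + mul1 t U D :=
  Subtype.ext (funext fun V => funext fun f => mul0_add s t V.1 (D.1 V f))

/-- Multiplication with a Poisson section `s`, as a morphism of complexes from
`𝒪 → T → ⋀²T` to `M → T ⊗ M → ⋀²T ⊗ M`. -/
def mulComplex (C : FlatConn P M) (s : H0 C.complex) :
    P.toFlatConn.complex ⟶ C.complex where
  τ₁ :=
    { app := fun U => AddCommGrpCat.ofHom (mul0 (C.sec s) U.unop)
      naturality := by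
        intro U V i
        ext f
        change S.res i.unop.le (asFn f) • resM M le_top (C.sec s) =
          resM M i.unop.le (asFn f • resM M le_top (C.sec s))
        rw [resM_smul, resM_resM] }
  τ₂ :=
    { app := fun U => AddCommGrpCat.ofHom (mul1 (C.sec s) U.unop)
      naturality := fun _ _ _ => rfl }
  τ₃ :=
    { app := fun U => AddCommGrpCat.ofHom (mul2 (C.sec s) U.unop)
      naturality := fun _ _ _ => rfl }
  comm₁₂ := by
    ext U f
    refine Subtype.ext ?_
    funext V g
    change C.bracket V.1 g (resM M V.2 (asFn f • resM M le_top (C.sec s))) =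
      P.bracket V.1 g (S.res V.2 (asFn f)) • resM M le_top (C.sec s)
    rw [resM_smul, resM_resM, C.leibniz_right, C.bracket_sec, smul_zero, add_zero]
  comm₂₃ := by
    ext U D
    exact v1_mul1 C s U D

/-- The map `m₁ : ℍ¹(𝒪) → Hom(ℍ⁰(M), ℍ¹(M))` induced by `a ↦ (s ↦ a ⊗ s)`. -/
def m1 (C : FlatConn P M) : H1 P.toFlatConn.complex →+ (H0 C.complex →+ H1 C.complex) :=
  AddMonoidHom.flip
    { toFun := fun s => mapH1 (mulComplex C s)
      map_zero' := by
        refine AddMonoidHom.ext fun a => H1_induction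
          (p := fun a => mapH1 (mulComplex C 0) a = 0) a fun 𝒰 c => ?_
        rw [mapH1_cls]
        refine (congrArg (cls C.complex 𝒰) (Subtype.ext (Prod.ext ?_ ?_))).trans (map_zero _)
        · exact funext fun x => funext fun y => mul0_zero _ _
        · exact funext fun x => mul1_zero _ _
      map_add' := fun s t => by
        refine AddMonoidHom.ext fun a => H1_induction
          (p := fun a => mapH1 (mulComplex C (s + t)) a =
            mapH1 (mulComplex C s) a + mapH1 (mulComplex C t) a) a fun 𝒰 c => ?_
        rw [mapH1_cls, mapH1_cls, mapH1_cls, ← map_add]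
        refine congrArg (cls C.complex 𝒰) (Subtype.ext (Prod.ext ?_ ?_))
        · exact funext fun x => funext fun y => mul0_add _ _ _ _
        · exact funext fun x => mul1_add _ _ _ _ }

end Mult

/-! ### The trivial first-order thickening -/

section Thick

/-- The homomorphism of dual numbers induced by a ring homomorphism. -/
def dualMap {A B : Type u} [CommRing A] [CommRing B] (φ : A →+* B) :
    DualNumber A →+* DualNumber B where
  toFun x := (φ x.fst, φ x.snd)
  map_one' := TrivSqZeroExt.ext (map_one φ) (map_zero φ)
  map_zero' := TrivSqZeroExt.ext (map_zero φ) (map_zero φ)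
  map_add' x y := TrivSqZeroExt.ext (map_add φ _ _) (map_add φ _ _)
  map_mul' x y := TrivSqZeroExt.ext (map_mul φ _ _) (by
    change φ (x.fst * y.snd + x.snd * y.fst) = φ x.fst * φ y.snd + φ x.snd * φ y.fst
    rw [map_add, map_mul, map_mul])

/-- The presheaf of dual numbers `U ↦ F(U)[ε]`. -/
def dualPresheaf {T : TopCat.{u}} (F : TopCat.Presheaf CommRingCat.{u} T) :
    TopCat.Presheaf CommRingCat.{u} T where
  obj U := .of (DualNumber (F.obj U))
  map i := CommRingCat.ofHom (dualMap (F.map i).hom)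
  map_id U := by
    refine CommRingCat.hom_ext (RingHom.ext fun x => TrivSqZeroExt.ext ?_ ?_)
    · exact congrArg (fun φ => φ.hom x.fst) (F.map_id U)
    · exact congrArg (fun φ => φ.hom x.snd) (F.map_id U)
  map_comp i j := by
    refine CommRingCat.hom_ext (RingHom.ext fun x => TrivSqZeroExt.ext ?_ ?_)
    · exact congrArg (fun φ => φ.hom x.fst) (F.map_comp i j)
    · exact congrArg (fun φ => φ.hom x.snd) (F.map_comp i j)

theorem dualPresheaf_isSheaf {T : TopCat.{u}} (F : TopCat.Presheaf CommRingCat.{u} T)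
    (hF : F.IsSheaf) : (dualPresheaf F).IsSheaf := by
  rw [TopCat.Presheaf.isSheaf_iff_isSheafUniqueGluing] at hF ⊢
  intro ι U sf h
  obtain ⟨a, ha, ha'⟩ := hF U (fun i => (sf i : DualNumber _).fst)
    (fun i j => congrArg TrivSqZeroExt.fst (h i j))
  obtain ⟨b, hb, hb'⟩ := hF U (fun i => (sf i : DualNumber _).snd)
    (fun i j => congrArg TrivSqZeroExt.snd (h i j))
  refine ⟨((a, b) : DualNumber _), fun i => TrivSqZeroExt.ext (ha i) (hb i), fun c hc => ?_⟩
  exact TrivSqZeroExt.ext (ha' _ fun i => congrArg TrivSqZeroExt.fst (hc i))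
    (hb' _ fun i => congrArg TrivSqZeroExt.snd (hc i))

variable {k : Type u} [CommRing k]

/-- The product of `S` with `Spec k[ε]`: the same topological space with the sheaf `𝒪_S ⊗ k[ε]`,
that is, `U ↦ 𝒪_S(U)[ε]`, as a sheaf of `k[ε]`-algebras. -/
abbrev AlgSpace.thick (S : AlgSpace k) : AlgSpace (DualNumber k) where
  space := S.space
  sheaf := ⟨dualPresheaf S.sheaf.presheaf, dualPresheaf_isSheaf _ S.sheaf.property⟩
  scalar := dualMap S.scalar

variable {S : AlgSpace k}

/-- Functions on the thickening are dual numbers over functions on `S`. -/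
def AlgSpace.toDual (U : Opens S.space) : S.thick.Fn U ≃+* DualNumber (S.Fn U) :=
  RingEquiv.refl (DualNumber (S.Fn U))

/-- The function `a + ε b`. -/
def AlgSpace.dual {U : Opens S.space} (a b : S.Fn U) : S.thick.Fn U :=
  (AlgSpace.toDual U).symm (a, b)

/-- The coefficient `a` of `a + ε b`. -/
def AlgSpace.re {U : Opens S.space} : S.thick.Fn U →+* S.Fn U :=
  (TrivSqZeroExt.fstHom (S.Fn U) (S.Fn U) (S.Fn U)).toRingHom.comp
    (AlgSpace.toDual U).toRingHom

/-- The coefficient `b` of `a + ε b`. -/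
def AlgSpace.im {U : Opens S.space} (f : S.thick.Fn U) : S.Fn U :=
  (AlgSpace.toDual U f).snd

theorem AlgSpace.dual_ext {U : Opens S.space} {f g : S.thick.Fn U} (h : re f = re g)
    (h' : im f = im g) : f = g := TrivSqZeroExt.ext h h'

theorem AlgSpace.im_mul {U : Opens S.space} (f g : S.thick.Fn U) :
    im (f * g) = re f * im g + im f * re g := rfl

/-- The trivial Poisson deformation: the `k[ε]`-bilinear extension of the Poisson bracket. -/
def PoissonStr.thick (P : PoissonStr S) : PoissonStr S.thick where
  bracket U f g := AlgSpace.dual (P.bracket U (re f) (re g))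
    (P.bracket U (re f) (im g) + P.bracket U (im f) (re g))
  add_left U f g h := by
    refine AlgSpace.dual_ext (P.add_left U _ _ _) ?_
    change P.bracket U (re f + re g) (im h) + P.bracket U (im f + im g) (re h) =
      (_ + _) + (_ + _)
    rw [P.add_left, P.add_left]; ring
  add_right U f g h := by
    refine AlgSpace.dual_ext (P.add_right U _ _ _) ?_
    change P.bracket U (re f) (im g + im h) + P.bracket U (im f) (re g + re h) =
      (_ + _) + (_ + _)
    rw [P.add_right, P.add_right]; ring
  scalar_left U c f g := by
    refine AlgSpace.dual_ext (P.scalar_left U _ _ _) ?_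
    change P.bracket U (S.const U c.fst * re f) (im g) +
        P.bracket U (S.const U c.fst * im f + S.const U c.snd * re f) (re g) =
      S.const U c.fst * (P.bracket U (re f) (im g) + P.bracket U (im f) (re g)) +
        S.const U c.snd * P.bracket U (re f) (re g)
    rw [P.add_left]
    simp only [P.scalar_left]; ring
  alternating U f := by
    refine AlgSpace.dual_ext (P.alternating U _) ?_
    change P.bracket U (re f) (im f) + P.bracket U (im f) (re f) = 0
    rw [P.skew]; ring
  leibniz U f g h := by
    refine AlgSpace.dual_ext (P.leibniz U _ _ _) ?_
    change P.bracket U (re f * re g) (im h) + P.bracket U (re f * im g + im f * re g) (re h) =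
      (re f * (P.bracket U (re g) (im h) + P.bracket U (im g) (re h)) +
        im f * P.bracket U (re g) (re h)) +
      (re g * (P.bracket U (re f) (im h) + P.bracket U (im f) (re h)) +
        im g * P.bracket U (re f) (re h))
    rw [P.add_left]
    simp only [P.leibniz]; ring
  jacobi U f g h := by
    refine AlgSpace.dual_ext (P.jacobi U _ _ _) ?_
    have h1 := P.jacobi U (im f) (re g) (re h)
    have h2 := P.jacobi U (re f) (im g) (re h)
    have h3 := P.jacobi U (re f) (re g) (im h)
    change (P.bracket U (re f) (P.bracket U (re g) (im h) + P.bracket U (im g) (re h)) +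
        P.bracket U (im f) (P.bracket U (re g) (re h))) +
      (P.bracket U (re g) (P.bracket U (re h) (im f) + P.bracket U (im h) (re f)) +
        P.bracket U (im g) (P.bracket U (re h) (re f))) +
      (P.bracket U (re h) (P.bracket U (re f) (im g) + P.bracket U (im f) (re g)) +
        P.bracket U (im h) (P.bracket U (re f) (re g))) = 0
    simp only [P.add_right]
    linear_combination h1 + h2 + h3
  res_bracket {U V} h f g := by
    refine AlgSpace.dual_ext (P.res_bracket h _ _) ?_
    change S.res h (P.bracket U (re f) (im g) + P.bracket U (im f) (re g)) =
      P.bracket V (S.res h (re f)) (S.res h (im g)) + P.bracket V (S.res h (im f)) (S.res h (re g))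
    rw [map_add, P.res_bracket, P.res_bracket]

end Thick

/-! ### First-order deformations of a Poisson invertible sheaf and extension of sections -/

section Deformation

variable {k : Type u} [CommRing k] {S : AlgSpace k} {P : PoissonStr S} {L : S.Modules}

/-- A first-order deformation of `(L, ∇)` over the trivial Poisson deformation: a Poisson invertible
sheaf over `k[ε]` on the thickening together with an identification of its restriction to `S` (its
quotient by the multiples of `ε`, with the induced bracket) with `(L, ∇)`. The identification is
given by the quotient map `restr` from `mod` onto `L = mod / ε mod`. -/
structure FirstOrderDef (C : FlatConn P L) where
  mod : S.thick.Modules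
  invertible : IsInvertible mod
  conn : FlatConn P.thick mod
  restr : ∀ U : Opens S.space, Sec (S := S.thick) mod U →+ Sec L U
  restr_smul : ∀ U (f : S.thick.Fn U) (m : Sec mod U), restr U (f • m) = re f • restr U m
  restr_res : ∀ {U V : Opens S.space} (h : V ≤ U) (m : Sec (S := S.thick) mod U),
    restr V (resM mod h m) = resM L h (restr U m)
  restr_surjective : ∀ (U : Opens S.space) (l : Sec L U), ∀ x ∈ U, ∃ (V : Opens S.space)
    (h : V ≤ U) (m : Sec (S := S.thick) mod V), x ∈ V ∧ restr V m = resM L h l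
  restr_eq_zero : ∀ (U : Opens S.space) (m : Sec (S := S.thick) mod U), restr U m = 0 ↔
    ∀ x ∈ U, ∃ (V : Opens S.space) (h : V ≤ U) (n : Sec (S := S.thick) mod V),
      x ∈ V ∧ resM mod h m = (AlgSpace.dual 0 1 : S.thick.Fn V) • n
  restr_bracket : ∀ U (f : S.thick.Fn U) (m : Sec mod U),
    restr U (conn.bracket U f m) = C.bracket U (re f) (restr U m)

namespace FirstOrderDef

variable {C : FlatConn P L} (𝒟 : FirstOrderDef C)

/-- The restriction map from Poisson sections of the deformation to Poisson sections of `(L, ∇)`. -/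
def restrH0 : H0 𝒟.conn.complex →+ H0 C.complex where
  toFun s := ⟨𝒟.restr ⊤ (𝒟.conn.sec s), by
    refine Subtype.ext ?_
    funext V f
    change C.bracket V.1 f (resM L V.2 (𝒟.restr ⊤ (𝒟.conn.sec s))) = 0
    have h := congrArg (𝒟.restr V.1) (𝒟.conn.bracket_sec s V.1 (AlgSpace.dual f 0))
    rw [𝒟.restr_bracket, map_zero, 𝒟.restr_res] at h
    exact h⟩
  map_zero' := Subtype.ext (map_zero _)
  map_add' _ _ := Subtype.ext (map_add _ _ _)

/-- A Poisson section of `(L, ∇)` extends to the deformation. -/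
def Extends (s : H0 C.complex) : Prop := s ∈ 𝒟.restrH0.range

/-- The deformation corresponds to `a ∈ ℍ¹(𝒪)`: over some cover `U_x` it has free generators `e_x`,
with transition functions `f_xy + ε g_xy` (so that `e_y = (f_xy + ε g_xy) e_x`) and connection
`{h, e_x} = (T_x(h) + ε W_x(h)) e_x`, such that `a` is the class of the Čech cocycle
`({g_xy / f_xy}, {W_x})`. -/
def Corresponds (a : H1 P.toFlatConn.complex) : Prop :=
  ∃ (𝒰 : PtCover S.space)
    (e : ∀ x, Sec (S := S.thick) 𝒟.mod (𝒰.nbhd x))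
    (f : ∀ x y, (S.Fn (𝒰.nbhd x ⊓ 𝒰.nbhd y))ˣ)
    (g : ∀ x y, S.Fn (𝒰.nbhd x ⊓ 𝒰.nbhd y))
    (T W : ∀ x, derOn S.unit (𝒰.nbhd x))
    (hz : ((fun x y => g x y * ((f x y)⁻¹).val, W) :
      C1 P.toFlatConn.complex 𝒰) ∈ Z1 P.toFlatConn.complex 𝒰),
    (∀ x, IsFrame 𝒟.mod (e x)) ∧
    (∀ x y, resM 𝒟.mod inf_le_right (e y) =
      (AlgSpace.dual (f x y : S.Fn _) (g x y) : S.thick.Fn _) • resM 𝒟.mod inf_le_left (e x)) ∧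
    (∀ x (V : OpensIn (𝒰.nbhd x)) (h : S.Fn V.1),
      𝒟.conn.bracket V.1 (AlgSpace.dual h 0) (resM 𝒟.mod V.2 (e x)) =
        (AlgSpace.dual (asFn ((T x).1 V h)) (asFn ((W x).1 V h)) : S.thick.Fn V.1) •
          resM 𝒟.mod V.2 (e x)) ∧
    a = cls P.toFlatConn.complex 𝒰 ⟨_, hz⟩

end FirstOrderDef

end Deformation

end PoissonSheaf

end

/-!
Multiplication by `ε` identifies `L` with the kernel of the restriction `ℒ → L`. If `s = aₓ ēₓ` on
`Uₓ`, where `ēₓ` is the restriction of the frame `eₓ` of `ℒ`, then the lifts `σₓ = aₓ eₓ` satisfy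
`σ_y - σₓ = ε (g_xy / f_xy) σₓ` and `{h, σₓ} = ε Wₓ(h) σₓ`: their failure to form a global Poisson
section is `ε` times the cocycle `a ⊗ s`. All other lifts are `σₓ - ε nₓ`, and these form a global
Poisson section if and only if the cochain `nₓ mod ε` of `L` bounds that cocycle.
-/

noncomputable section

namespace PoissonSheaf

namespace AlgSpace

section Modules

variable {K : Type u} [CommRing K] {S : AlgSpace K} {M : S.Modules} {U : Opens S.space}

theorem sec_eq_of_locally_eq {s t : Sec M U}
    (hst : ∀ x ∈ U, ∃ (V : Opens S.space) (h : V ≤ U), x ∈ V ∧ resM M h s = resM M h t) :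
    s = t := by
  choose! V hVU hxV hV using fun x : U => hst x.1 x.2
  exact TopCat.Sheaf.eq_of_locally_eq' (C := AddCommGrpCat.{u}) ⟨M.val.presheaf, M.isSheaf⟩
    V U (fun x => homOfLE (hVU x)) (fun x hx => Opens.mem_iSup.mpr ⟨⟨x, hx⟩, hxV _⟩) s t hV

theorem exists_forall_resM_eq {ι : Type u} {V : ι → Opens S.space} (hVU : ∀ i, V i ≤ U)
    (hcover : U ≤ ⨆ i, V i) (s : ∀ i, Sec M (V i))
    (hs : ∀ i j, resM M (inf_le_left : V i ⊓ V j ≤ V i) (s i) = resM M inf_le_right (s j)) :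
    ∃ t : Sec M U, ∀ i, resM M (hVU i) t = s i :=
  (TopCat.Sheaf.existsUnique_gluing' (C := AddCommGrpCat.{u}) ⟨M.val.presheaf, M.isSheaf⟩
    V U (fun i => homOfLE (hVU i)) hcover s hs).exists

theorem IsFrame.resM {e : Sec M U} (he : IsFrame M e) {V : Opens S.space} (h : V ≤ U) :
    IsFrame M (resM M h e) := by
  intro W hW
  simpa only [resM_resM] using he W (hW.trans h)

theorem IsFrame.exists_smul_eq {e : Sec M U} (he : IsFrame M e) (m : Sec M U) :
    ∃ r : S.Fn U, r • e = m := by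
  obtain ⟨r, hr⟩ := (he U le_rfl).2 m
  exact ⟨r, by rwa [resM_self] at hr⟩

theorem IsFrame.smul_left_injective {e : Sec M U} (he : IsFrame M e) :
    Function.Injective fun r : S.Fn U => r • e := by
  simpa only [resM_self] using (he U le_rfl).1

theorem isFrame_of_locally_surjective {e : Sec M U}
    (hinj : ∀ (V : Opens S.space) (h : V ≤ U),
      Function.Injective fun r : S.Fn V => r • AlgSpace.resM M h e)
    (hsurj : ∀ (V : Opens S.space) (h : V ≤ U) (m : Sec M V), ∀ x ∈ V,
      ∃ (W : Opens S.space) (i : W ≤ V) (r : S.Fn W),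
        x ∈ W ∧ r • AlgSpace.resM M (i.trans h) e = AlgSpace.resM M i m) :
    IsFrame M e := by
  refine fun V h => ⟨hinj V h, fun m => ?_⟩
  choose! W hWV r hxW hr using fun x : V => hsurj V h m x.1 x.2
  have hr' (x : V) (W' : Opens S.space) (i : W' ≤ W x) :
      S.res i (r x) • AlgSpace.resM M (i.trans ((hWV x).trans h)) e =
        AlgSpace.resM M (i.trans (hWV x)) m := by
    simpa only [resM_smul, resM_resM] using congrArg (AlgSpace.resM M i) (hr x)
  obtain ⟨q, hq⟩ := exists_forall_resM_eq (M := S.unit) hWV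
    (fun x hx => Opens.mem_iSup.mpr ⟨⟨x, hx⟩, hxW _⟩) r
    fun x y => hinj _ _ ((hr' x _ inf_le_left).trans (hr' y _ inf_le_right).symm)
  refine ⟨asFn q, sec_eq_of_locally_eq fun x hx => ⟨W ⟨x, hx⟩, hWV _, hxW _, ?_⟩⟩
  rw [resM_smul, resM_resM, ← asFn_resM, hq]
  exact hr _

end Modules

section DualNumbers

variable {k : Type u} [CommRing k] {S : AlgSpace k} {U : Opens S.space}

/-- The function `ε` on the thickening of `S`, in the form used by `FirstOrderDef.restr_eq_zero`. -/
abbrev eps (S : AlgSpace k) (U : Opens S.space) : S.thick.Fn U := dual 0 1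

theorem dual_re_im (f : S.thick.Fn U) : dual (re f) (im f) = f := rfl

theorem dual_zero_zero : (dual 0 0 : S.thick.Fn U) = 0 := rfl

theorem dual_add (a b c d : S.Fn U) :
    (dual a b + dual c d : S.thick.Fn U) = dual (a + c) (b + d) := rfl

theorem dual_sub (a b c d : S.Fn U) :
    (dual a b - dual c d : S.thick.Fn U) = dual (a - c) (b - d) := rfl

theorem dual_mul (a b c d : S.Fn U) :
    (dual a b * dual c d : S.thick.Fn U) = dual (a * c) (a * d + b * c) := rfl

theorem res_dual {V : Opens S.space} (h : V ≤ U) (a b : S.Fn U) :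
    S.thick.res h (dual a b) = dual (S.res h a) (S.res h b) := rfl

theorem res_eps {V : Opens S.space} (h : V ≤ U) : S.thick.res h (S.eps U) = S.eps V := by
  rw [res_dual, map_zero, map_one]

theorem re_dual (a b : S.Fn U) : re (dual a b) = a := rfl

theorem eps_mul (f : S.thick.Fn U) : S.eps U * f = dual 0 (re f) := by
  rw [← dual_re_im f, dual_mul, zero_mul, zero_mul, one_mul, zero_add, re_dual]

theorem eps_mul_eps : S.eps U * S.eps U = 0 := eps_mul _

theorem const_eps : S.thick.const U (DualNumber.eps : DualNumber k) = S.eps U :=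
  dual_ext (map_zero (S.const U)) (map_one (S.const U))

end DualNumbers

end AlgSpace

open AlgSpace

section Cech

variable {T : TopCat.{u}} {C D : ShortComplex (TopCat.Presheaf AddCommGrpCat.{u} T)}
  {𝒰 𝒱 : PtCover T}

theorem mapZ_refineZ (φ : C ⟶ D) (h : 𝒰 ≤ 𝒱) (z : Z1 C 𝒰) :
    mapZ φ 𝒱 (refineZ C h z) = refineZ D h (mapZ φ 𝒰 z) :=
  Subtype.ext (Prod.ext (funext fun _ => funext fun _ => ap_rs φ.τ₁ _ _)
    (funext fun _ => ap_rs φ.τ₂ _ _))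

instance : DirectedSystem (CechH1 C) fun _ _ h => refine C h where
  map_self _ c := by
    obtain ⟨z, rfl⟩ := QuotientAddGroup.mk_surjective c
    exact congrArg QuotientAddGroup.mk (Subtype.ext (Prod.ext
      (funext fun _ => funext fun _ => rs_self _ _) (funext fun _ => rs_self _ _)))
  map_map _ _ _ _ _ c := by
    obtain ⟨z, rfl⟩ := QuotientAddGroup.mk_surjective c
    exact congrArg QuotientAddGroup.mk (Subtype.ext (Prod.ext
      (funext fun _ => funext fun _ => rs_rs _ _ _ _) (funext fun _ => rs_rs _ _ _ _)))

theorem cls_refineZ (h : 𝒰 ≤ 𝒱) (z : Z1 C 𝒰) : cls C 𝒱 (refineZ C h z) = cls C 𝒰 z := by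
  classical
  exact AddCommGroup.DirectLimit.of_f (G := CechH1 C) (f := fun _ _ h => refine C h)
    (hij := h) (x := QuotientAddGroup.mk z)

theorem cls_eq_zero_of_mem_B1 {z : Z1 C 𝒰} (hz : z ∈ B1 C 𝒰) : cls C 𝒰 z = 0 := by
  classical
  exact (congrArg (AddCommGroup.DirectLimit.of (CechH1 C) (fun _ _ h => refine C h) 𝒰)
    ((QuotientAddGroup.eq_zero_iff z).mpr hz)).trans (map_zero _)

theorem cls_eq_zero_iff (z : Z1 C 𝒰) :
    cls C 𝒰 z = 0 ↔ ∃ (𝒱 : PtCover T) (h : 𝒰 ≤ 𝒱), refineZ C h z ∈ B1 C 𝒱 := by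
  classical
  constructor
  · intro hz
    obtain ⟨𝒱, h, hz𝒱⟩ := AddCommGroup.DirectLimit.of.zero_exact (G := CechH1 C)
      (f := fun _ _ h => refine C h) 𝒰 (QuotientAddGroup.mk z) hz
    exact ⟨𝒱, h, (QuotientAddGroup.eq_zero_iff _).mp hz𝒱⟩
  · rintro ⟨𝒱, h, hz𝒱⟩
    rw [← cls_refineZ h, cls_eq_zero_of_mem_B1 hz𝒱]

end Cech

section PoissonModules

variable {K : Type u} [CommRing K] {S : AlgSpace K} {P : PoissonStr S} {M : S.Modules}

theorem FlatConn.bracket_sub (C : FlatConn P M) (U : Opens S.space) (f : S.Fn U) (m n : Sec M U) :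
    C.bracket U f (m - n) = C.bracket U f m - C.bracket U f n :=
  map_sub (AddMonoidHom.mk' (C.bracket U f) (C.add_right U f)) m n

theorem FlatConn.mem_H0_iff (C : FlatConn P M) (s : Sec M ⊤) :
    s ∈ H0 C.complex ↔ ∀ V (f : S.Fn V), C.bracket V f (resM M le_top s) = 0 :=
  ⟨fun hs => C.bracket_sec ⟨s, hs⟩,
    fun hs => Subtype.ext (funext fun V => funext fun f => hs V.1 f)⟩

theorem m1_cls (C : FlatConn P M) {𝒰 : PtCover S.space} (z : Z1 P.toFlatConn.complex 𝒰)
    (s : H0 C.complex) :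
    m1 C (cls _ 𝒰 z) s = cls _ 𝒰 (mapZ (mulComplex C s) 𝒰 z) :=
  mapH1_cls (mulComplex C s) 𝒰 z

theorem mapZ_mulComplex_mem_B1_iff (C : FlatConn P M) {𝒰 : PtCover S.space}
    (z : Z1 P.toFlatConn.complex 𝒰) (s : H0 C.complex) :
    mapZ (mulComplex C s) 𝒰 z ∈ B1 C.complex 𝒰 ↔
      ∃ t : ∀ x, Sec M (𝒰.nbhd x),
        (∀ x y, resM M inf_le_right (t y) - resM M inf_le_left (t x) =
          asFn (z.1.1 x y) • resM M le_top (C.sec s)) ∧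
        ∀ x (V : OpensIn (𝒰.nbhd x)) (f : S.Fn V.1), C.bracket V.1 f (resM M V.2 (t x)) =
          asFn ((z.1.2 x : derOn S.unit (𝒰.nbhd x)).1 V f) • resM M le_top (C.sec s) := by
  refine exists_congr fun t => Prod.ext_iff.trans (and_congr ?_ ?_)
  · exact funext_iff.trans (forall_congr' fun _ => funext_iff)
  · exact funext_iff.trans (forall_congr' fun _ => Subtype.ext_iff.trans
      (funext_iff.trans (forall_congr' fun _ => funext_iff)))

end PoissonModules

section Thickening

variable {k : Type u} [CommRing k] {S : AlgSpace k} {P : PoissonStr S} {M : S.thick.Modules}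

theorem PoissonStr.thick_bracket_dual_zero (P : PoissonStr S) (U : Opens S.space) (f g : S.Fn U) :
    P.thick.bracket U (dual f 0) (dual g 0) = dual (P.bracket U f g) 0 := by
  refine dual_ext rfl ?_
  have hright : P.bracket U f 0 = 0 := P.toFlatConn.bracket_zero U f
  have hleft : P.bracket U 0 g = 0 := by
    rw [P.skew, neg_eq_zero]
    exact P.toFlatConn.bracket_zero U g
  exact (congrArg₂ (· + ·) hright hleft).trans (add_zero 0)

theorem FlatConn.bracket_eps_smul (C : FlatConn P.thick M) (U : Opens S.space) (f : S.thick.Fn U)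
    (m : Sec M U) : C.bracket U f (S.eps U • m) = S.eps U • C.bracket U f m := by
  rw [← const_eps, C.scalar_right]

theorem FlatConn.bracket_dual (C : FlatConn P.thick M) (U : Opens S.space) (f g : S.Fn U)
    (m : Sec M U) :
    C.bracket U (dual f g) m = C.bracket U (dual f 0) m + S.eps U • C.bracket U (dual g 0) m := by
  rw [← const_eps, ← C.scalar_left, ← C.add_left, const_eps, eps_mul, re_dual, dual_add, add_zero,
    zero_add]

end Thickening

namespace FirstOrderDef

variable {k : Type u} [CommRing k] {S : AlgSpace k} {P : PoissonStr S} {L : S.Modules}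
  {C : FlatConn P L} (𝒟 : FirstOrderDef C) {U : Opens S.space} {e : Sec (S := S.thick) 𝒟.mod U}

section Exactness

theorem eps_smul_eq_zero_iff (m : Sec (S := S.thick) 𝒟.mod U) :
    S.eps U • m = 0 ↔ 𝒟.restr U m = 0 := by
  constructor
  · refine fun hm => sec_eq_of_locally_eq fun x hx => ?_
    obtain ⟨V, e, hxV, he⟩ := 𝒟.invertible x
    refine ⟨U ⊓ V, inf_le_left, ⟨hx, hxV⟩, ?_⟩
    obtain ⟨r, hr⟩ := (he.resM (inf_le_right : U ⊓ V ≤ V)).exists_smul_eq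
      (resM 𝒟.mod inf_le_left m)
    have hεr : (S.eps (U ⊓ V) * r) • resM 𝒟.mod (inf_le_right : U ⊓ V ≤ V) e =
        (0 : S.thick.Fn (U ⊓ V)) • resM 𝒟.mod (inf_le_right : U ⊓ V ≤ V) e := by
      rw [mul_smul, hr, ← res_eps inf_le_left, ← resM_smul, hm, map_zero, zero_smul]
    have hre : re r = 0 := by
      have := (he.resM inf_le_right).smul_left_injective hεr
      rw [eps_mul] at this
      exact congrArg im this
    rw [map_zero, ← 𝒟.restr_res, ← hr, 𝒟.restr_smul, hre, zero_smul]
  · refine fun hm => sec_eq_of_locally_eq fun x hx => ?_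
    obtain ⟨V, h, n, hxV, hn⟩ := (𝒟.restr_eq_zero U m).mp hm x hx
    refine ⟨V, h, hxV, ?_⟩
    rw [resM_smul, hn, res_eps, ← mul_smul, eps_mul_eps, zero_smul, map_zero]

theorem eps_smul_eq_dual_smul_iff (u : S.Fn U) (m n : Sec (S := S.thick) 𝒟.mod U) :
    S.eps U • n = (dual 0 u : S.thick.Fn U) • m ↔ 𝒟.restr U n = u • 𝒟.restr U m := by
  have hu : (dual 0 u : S.thick.Fn U) = S.eps U * dual u 0 := (eps_mul (dual u 0)).symm
  rw [hu, mul_smul, ← sub_eq_zero, ← smul_sub, eps_smul_eq_zero_iff, map_sub, 𝒟.restr_smul,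
    re_dual, sub_eq_zero]

variable {𝒟}

theorem isFrame_restr (he : IsFrame 𝒟.mod e) : IsFrame L (𝒟.restr U e) := by
  refine isFrame_of_locally_surjective (fun V h a b hab => ?_) fun V h l x hx => ?_
  · have hrestr : 𝒟.restr V ((dual (a - b) 0 : S.thick.Fn V) • resM 𝒟.mod h e) = 0 := by
      rw [𝒟.restr_smul, re_dual, 𝒟.restr_res, sub_smul, sub_eq_zero]
      exact hab
    rw [← eps_smul_eq_zero_iff, ← mul_smul, eps_mul, re_dual,
      ← zero_smul (S.thick.Fn V) (resM 𝒟.mod h e)] at hrestr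
    exact sub_eq_zero.mp (congrArg im ((he V h).1 hrestr))
  · obtain ⟨W, i, m, hxW, hm⟩ := 𝒟.restr_surjective V l x hx
    obtain ⟨r, rfl⟩ := (he W (i.trans h)).2 m
    exact ⟨W, i, re r, hxW, by rw [← hm, 𝒟.restr_smul, 𝒟.restr_res]⟩

theorem restr_surjective_of_isFrame (he : IsFrame 𝒟.mod e) :
    Function.Surjective (𝒟.restr U) := by
  intro l
  obtain ⟨a, rfl⟩ := (isFrame_restr he).exists_smul_eq l
  exact ⟨(dual a 0 : S.thick.Fn U) • e, by rw [𝒟.restr_smul, re_dual]⟩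

theorem exists_eps_smul_eq_of_isFrame (he : IsFrame 𝒟.mod e) {m : Sec (S := S.thick) 𝒟.mod U}
    (hm : 𝒟.restr U m = 0) : ∃ n : Sec (S := S.thick) 𝒟.mod U, S.eps U • n = m := by
  obtain ⟨r, rfl⟩ := he.exists_smul_eq m
  have hre : re r = 0 := (isFrame_restr he).smul_left_injective <| by
    simpa only [𝒟.restr_smul, zero_smul] using hm
  refine ⟨(dual (im r) 0 : S.thick.Fn U) • e, ?_⟩
  rw [← mul_smul, eps_mul, re_dual, ← hre, dual_re_im]

end Exactness

section FrameCoordinates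

variable {𝒟}

theorem dual_smul_sub_dual_smul (he : IsFrame 𝒟.mod e) {e' : Sec (S := S.thick) 𝒟.mod U}
    {f : (S.Fn U)ˣ} {g : S.Fn U} (he' : e' = (dual (f : S.Fn U) g : S.thick.Fn U) • e)
    {a a' : S.Fn U} (haa' : a' • 𝒟.restr U e' = a • 𝒟.restr U e) :
    (dual a' 0 : S.thick.Fn U) • e' - (dual a 0 : S.thick.Fn U) • e =
      (dual 0 (g * (f⁻¹).val) : S.thick.Fn U) • (dual a 0 : S.thick.Fn U) • e := by
  have ha : a = a' * f := (isFrame_restr he).smul_left_injective <| by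
    simpa only [he', 𝒟.restr_smul, re_dual, smul_smul] using haa'.symm
  rw [he', ← mul_smul, ← mul_smul, ← sub_smul, dual_mul, dual_mul, dual_sub]
  congr 2
  · linear_combination -ha
  · linear_combination -(g * (f⁻¹).val) * ha - a' * g * f.mul_inv

theorem bracket_dual_smul_of_bracket_restr_eq_zero (he : IsFrame 𝒟.mod e) {h τ ω : S.Fn U}
    (hconn : 𝒟.conn.bracket U (dual h 0) e = (dual τ ω : S.thick.Fn U) • e) {a : S.Fn U}
    (ha : C.bracket U h (a • 𝒟.restr U e) = 0) :
    𝒟.conn.bracket U (dual h 0) ((dual a 0 : S.thick.Fn U) • e) =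
      (dual 0 ω : S.thick.Fn U) • (dual a 0 : S.thick.Fn U) • e := by
  have hbracket : 𝒟.conn.bracket U (dual h 0) ((dual a 0 : S.thick.Fn U) • e) =
      (dual (P.bracket U h a + a * τ) (a * ω) : S.thick.Fn U) • e := by
    rw [𝒟.conn.leibniz_right, hconn, P.thick_bracket_dual_zero, ← mul_smul, ← add_smul, dual_mul,
      dual_add, zero_mul, add_zero, zero_add]
  have hflat : P.bracket U h a + a * τ = 0 := (isFrame_restr he).smul_left_injective <| by
    simpa only [𝒟.restr_bracket, 𝒟.restr_smul, re_dual, ha, zero_smul] using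
      (congrArg (𝒟.restr U) hbracket).symm
  rw [hbracket, hflat, ← mul_smul, dual_mul, zero_mul, zero_mul, zero_add, mul_comm a]

end FrameCoordinates

section LocalLifts

variable {𝒰 𝒱 : PtCover S.space} {z : Z1 P.toFlatConn.complex 𝒰} {s : H0 C.complex}
  {σ : ∀ x, Sec (S := S.thick) 𝒟.mod (𝒰.nbhd x)}

/-- Lifts `σ x` of the Poisson section `s` to the deformation over the members of a cover, whose
failure to agree on overlaps and to be Poisson is given by `ε z`, where `z` is a Čech cocycle of
functions and vector fields. -/
structure IsLocalLift (z : Z1 P.toFlatConn.complex 𝒰) (s : H0 C.complex)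
    (σ : ∀ x, Sec (S := S.thick) 𝒟.mod (𝒰.nbhd x)) : Prop where
  restr_eq : ∀ x, 𝒟.restr _ (σ x) = resM L le_top (C.sec s)
  sub_eq : ∀ x y, resM 𝒟.mod inf_le_right (σ y) - resM 𝒟.mod inf_le_left (σ x) =
    (dual 0 (asFn (z.1.1 x y)) : S.thick.Fn (𝒰.nbhd x ⊓ 𝒰.nbhd y)) • resM 𝒟.mod inf_le_left (σ x)
  bracket_eq : ∀ x (V : OpensIn (𝒰.nbhd x)) (f : S.thick.Fn V.1),
    𝒟.conn.bracket V.1 f (resM 𝒟.mod V.2 (σ x)) =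
      (dual 0 (asFn ((z.1.2 x : derOn S.unit (𝒰.nbhd x)).1 V (re f))) : S.thick.Fn V.1) •
        resM 𝒟.mod V.2 (σ x)

variable {𝒟}

namespace IsLocalLift

theorem restr_resM_eq (hσ : 𝒟.IsLocalLift z s σ) {x : S.space} {V : Opens S.space}
    (h : V ≤ 𝒰.nbhd x) : 𝒟.restr V (resM 𝒟.mod h (σ x)) = resM L le_top (C.sec s) := by
  rw [𝒟.restr_res, hσ.restr_eq, resM_resM]

theorem refine (hσ : 𝒟.IsLocalLift z s σ) (h : 𝒰 ≤ 𝒱) :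
    𝒟.IsLocalLift (refineZ _ h z) s fun x => resM 𝒟.mod (h x) (σ x) where
  restr_eq x := hσ.restr_resM_eq (h x)
  sub_eq x y := by
    have hxy := congrArg (resM 𝒟.mod (inf_le_inf (h x) (h y))) (hσ.sub_eq x y)
    simp only [map_sub, resM_smul, resM_resM, res_dual, map_zero] at hxy ⊢
    exact hxy
  bracket_eq x V f := by
    simp only [resM_resM]
    exact hσ.bracket_eq x ⟨V.1, V.2.trans (h x)⟩ f

theorem resM_sub_eps_smul_eq_iff (hσ : 𝒟.IsLocalLift z s σ)
    (n : ∀ x, Sec (S := S.thick) 𝒟.mod (𝒰.nbhd x)) (x y : S.space) :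
    resM 𝒟.mod (inf_le_left : 𝒰.nbhd x ⊓ 𝒰.nbhd y ≤ _) (σ x - S.eps (𝒰.nbhd x) • n x) =
        resM 𝒟.mod inf_le_right (σ y - S.eps (𝒰.nbhd y) • n y) ↔
      resM L inf_le_right (𝒟.restr _ (n y)) - resM L inf_le_left (𝒟.restr _ (n x)) =
        asFn (z.1.1 x y) • resM L le_top (C.sec s) := by
  rw [← hσ.restr_resM_eq (inf_le_left : 𝒰.nbhd x ⊓ 𝒰.nbhd y ≤ _), ← 𝒟.restr_res, ← 𝒟.restr_res,
    ← map_sub, ← eps_smul_eq_dual_smul_iff, ← hσ.sub_eq, smul_sub]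
  simp only [map_sub, resM_smul, res_eps]
  rw [sub_eq_sub_iff_add_eq_add, sub_eq_sub_iff_add_eq_add, add_comm (resM _ _ _)]

theorem bracket_sub_eps_smul_eq_zero_iff (hσ : 𝒟.IsLocalLift z s σ) {x : S.space}
    (n : Sec (S := S.thick) 𝒟.mod (𝒰.nbhd x)) (V : OpensIn (𝒰.nbhd x)) (f : S.thick.Fn V.1) :
    𝒟.conn.bracket V.1 f (resM 𝒟.mod V.2 (σ x - S.eps (𝒰.nbhd x) • n)) = 0 ↔
      C.bracket V.1 (re f) (resM L V.2 (𝒟.restr _ n)) =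
        asFn ((z.1.2 x : derOn S.unit (𝒰.nbhd x)).1 V (re f)) • resM L le_top (C.sec s) := by
  rw [map_sub, resM_smul, res_eps, 𝒟.conn.bracket_sub, 𝒟.conn.bracket_eps_smul, hσ.bracket_eq,
    sub_eq_zero, eq_comm, eps_smul_eq_dual_smul_iff, 𝒟.restr_bracket, hσ.restr_resM_eq V.2,
    𝒟.restr_res]

theorem extends_iff_exists_sub_eps_smul (hσ : 𝒟.IsLocalLift z s σ)
    {e : ∀ x, Sec (S := S.thick) 𝒟.mod (𝒰.nbhd x)} (he : ∀ x, IsFrame 𝒟.mod (e x)) :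
    𝒟.Extends s ↔ ∃ n : ∀ x, Sec (S := S.thick) 𝒟.mod (𝒰.nbhd x),
      (∀ x y, resM 𝒟.mod (inf_le_left : 𝒰.nbhd x ⊓ 𝒰.nbhd y ≤ _) (σ x - S.eps (𝒰.nbhd x) • n x) =
        resM 𝒟.mod inf_le_right (σ y - S.eps (𝒰.nbhd y) • n y)) ∧
      ∀ x (V : OpensIn (𝒰.nbhd x)) (f : S.thick.Fn V.1),
        𝒟.conn.bracket V.1 f (resM 𝒟.mod V.2 (σ x - S.eps (𝒰.nbhd x) • n x)) = 0 := by
  constructor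
  · rintro ⟨τ, rfl⟩
    have hrestr (x) : 𝒟.restr _ (σ x - resM 𝒟.mod le_top (𝒟.conn.sec τ)) = 0 := by
      rw [map_sub, hσ.restr_eq, 𝒟.restr_res, sub_eq_zero]
      rfl
    choose n hn using fun x => exists_eps_smul_eq_of_isFrame (he x) (hrestr x)
    refine ⟨n, fun x y => ?_, fun x V f => ?_⟩
    · simp only [hn, sub_sub_cancel, resM_resM]
    · rw [hn, sub_sub_cancel, resM_resM, 𝒟.conn.bracket_sec]
  · rintro ⟨n, hglue, hflat⟩
    obtain ⟨τ, hτ⟩ := exists_forall_resM_eq (S := S.thick) (fun _ => le_top)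
      (fun x _ => Opens.mem_iSup.mpr ⟨x, 𝒰.mem x⟩) _ hglue
    refine ⟨⟨τ, (𝒟.conn.mem_H0_iff τ).mpr fun V f => ?_⟩, Subtype.ext ?_⟩
    · refine sec_eq_of_locally_eq (S := S.thick) fun x hxV =>
        ⟨V ⊓ 𝒰.nbhd x, inf_le_left, ⟨hxV, 𝒰.mem x⟩, ?_⟩
      rw [𝒟.conn.res_bracket, resM_resM, map_zero, ← hflat x ⟨V ⊓ 𝒰.nbhd x, inf_le_right⟩, ← hτ,
        resM_resM]
    · refine sec_eq_of_locally_eq fun x _ => ⟨𝒰.nbhd x, le_top, 𝒰.mem x, ?_⟩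
      change resM L le_top (𝒟.restr ⊤ τ) = resM L le_top (C.sec s)
      rw [← 𝒟.restr_res, hτ, map_sub, 𝒟.restr_smul, re_dual, zero_smul, sub_zero, hσ.restr_eq]

theorem extends_iff_mem_B1 (hσ : 𝒟.IsLocalLift z s σ)
    {e : ∀ x, Sec (S := S.thick) 𝒟.mod (𝒰.nbhd x)} (he : ∀ x, IsFrame 𝒟.mod (e x)) :
    𝒟.Extends s ↔ mapZ (mulComplex C s) 𝒰 z ∈ B1 C.complex 𝒰 := by
  have hsurj : Function.Surjective fun (n : ∀ x, Sec (S := S.thick) 𝒟.mod (𝒰.nbhd x)) x =>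
      𝒟.restr _ (n x) := Function.Surjective.piMap fun x => restr_surjective_of_isFrame (he x)
  rw [hσ.extends_iff_exists_sub_eps_smul he, mapZ_mulComplex_mem_B1_iff, hsurj.exists]
  refine exists_congr fun n => and_congr ?_ ?_
  · exact forall₂_congr fun x y => hσ.resM_sub_eps_smul_eq_iff n x y
  · refine forall₂_congr fun x V => ?_
    simp only [hσ.bracket_sub_eps_smul_eq_zero_iff]
    exact ⟨fun h f => h (dual f 0), fun h f => h (re f)⟩

theorem extends_iff_m1_cls_eq_zero (hσ : 𝒟.IsLocalLift z s σ)
    {e : ∀ x, Sec (S := S.thick) 𝒟.mod (𝒰.nbhd x)} (he : ∀ x, IsFrame 𝒟.mod (e x)) :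
    𝒟.Extends s ↔ m1 C (cls _ 𝒰 z) s = 0 := by
  have hrefine (𝒱 : PtCover S.space) (h : 𝒰 ≤ 𝒱) :
      refineZ _ h (mapZ (mulComplex C s) 𝒰 z) ∈ B1 C.complex 𝒱 ↔ 𝒟.Extends s := by
    rw [← mapZ_refineZ, (hσ.refine h).extends_iff_mem_B1 fun x => (he x).resM (h x)]
  simp only [m1_cls, cls_eq_zero_iff, hrefine]
  exact ⟨fun hs => ⟨𝒰, le_rfl, hs⟩, fun ⟨_, _, hs⟩ => hs⟩

end IsLocalLift

theorem Corresponds.exists_isLocalLift {a : H1 P.toFlatConn.complex} (ha : 𝒟.Corresponds a)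
    (s : H0 C.complex) :
    ∃ (𝒰 : PtCover S.space) (z : Z1 P.toFlatConn.complex 𝒰)
      (e σ : ∀ x, Sec (S := S.thick) 𝒟.mod (𝒰.nbhd x)),
      a = cls _ 𝒰 z ∧ (∀ x, IsFrame 𝒟.mod (e x)) ∧ 𝒟.IsLocalLift z s σ := by
  obtain ⟨𝒰, e, f, g, T, W, hz, he, htrans, hconn, rfl⟩ := ha
  choose a ha using fun x => (isFrame_restr (he x)).exists_smul_eq (resM L le_top (C.sec s))
  have haV (x) (V : Opens S.space) (h : V ≤ 𝒰.nbhd x) :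
      S.res h (a x) • 𝒟.restr V (resM 𝒟.mod h (e x)) = resM L le_top (C.sec s) := by
    rw [𝒟.restr_res, ← resM_smul, ha, resM_resM]
  refine ⟨𝒰, ⟨_, hz⟩, e, fun x => (dual (a x) 0 : S.thick.Fn (𝒰.nbhd x)) • e x, rfl, he, ?_, ?_, ?_⟩
  · intro x
    rw [𝒟.restr_smul, re_dual, ha]
  · intro x y
    simp only [resM_smul, res_dual, map_zero]
    exact dual_smul_sub_dual_smul ((he x).resM inf_le_left) (htrans x y)
      ((haV y _ inf_le_right).trans (haV x _ inf_le_left).symm)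
  · intro x V F
    have hbracket (h : S.Fn V.1) := bracket_dual_smul_of_bracket_restr_eq_zero
      ((he x).resM V.2) (hconn x V h) (a := S.res V.2 (a x)) (by rw [haV, C.bracket_sec])
    simp only [resM_smul, res_dual, map_zero]
    rw [← dual_re_im F, 𝒟.conn.bracket_dual, hbracket, hbracket, ← mul_smul (S.eps V.1), eps_mul,
      re_dual, re_dual, dual_zero_zero, zero_smul, add_zero]

end LocalLifts

end FirstOrderDef

end PoissonSheaf

end

open PoissonSheaf in
theorem mainTheorem10_general {k : Type u} [CommRing k] {S : AlgSpace k} {P : PoissonStr S}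
    {L : S.Modules} {C : FlatConn P L} {a : H1 P.toFlatConn.complex} {𝒟 : FirstOrderDef C}
    (ha : 𝒟.Corresponds a) (s : H0 C.complex) :
    𝒟.Extends s ↔ m1 C a s = 0 := by
  obtain ⟨𝒰, z, e, σ, rfl, he, hσ⟩ := ha.exists_isLocalLift s
  exact hσ.extends_iff_m1_cls_eq_zero he

open PoissonSheaf in
theorem mainTheorem10 {k : Type u} [Field k] [IsAlgClosed k] [CharZero k]
    (X : Scheme.{u}) (π : X ⟶ Spec (.of k)) [IsIntegral X] [Smooth π] [IsSeparated π]
    [LocallyOfFiniteType π] [QuasiCompact π]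
    (P : PoissonStr (ofScheme X π))
    (L : (ofScheme X π).Modules) (hL : AlgSpace.IsInvertible L) (C : FlatConn P L)
    (a : H1 P.toFlatConn.complex) (𝒟 : FirstOrderDef C) (ha : 𝒟.Corresponds a)
    (s : H0 C.complex) :
    𝒟.Extends s ↔ m1 C a s = 0 :=
  mainTheorem10_general ha s
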